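/- For real numbers $p,q,r,s,t$ let $f(x)=x^5+px^4+qx^3+rx^2+sx+t$, and put $$D = 256p^5t^3 - 192p^4qst^2 - 128p^4r^2t^2 + 144p^4rs^2t + 144p^3q^2rt^2 - 6p^3q^2s^2t - 80p^3qr^2st + 16p^3r^4t - 27p^2q^4t^2 + 18p^2q^3rst - 4p^2q^2r^3t - 1600p^3qt^3 + 160p^3rst^2 - 36p^3s^3t + 1020p^2q^2st^2 + 560p^2qr^2t^2 - 746p^2qrs^2t + 24p^2r^3st - 630pq^3rt^2 + 24pq^3s^2t + 356pq^2r^2st - 72pqr^4t + 108q^5t^2 - 72q^4rst + 16q^3r^3t + 2000p^2rt^3 - 50p^2s^2t^2 + 2250pq^2t^3 - 2050pqrst^2 + 160pqs^3t - 900pr^3t^2 + 1020pr^2s^2t - 900q^3st^2 + 825q^2r^2t^2 + 560q^2rs^2t - 630qr^3st - 2500pst^3 - 3750qrt^3 + 2000qs^2t^2 + 108r^5t - 27r^4s^2 + 2250r^2st^2 - 1600rs^3t + 256s^5 + 3125t^4 - 27p^4s^4 + 18p^3qrs^3 - 4p^3r^3s^2 - 4p^2q^3s^3 + p^2q^2r^2s^2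 + 144p^2qs^4 - 6p^2r^2s^3 - 80pq^2rs^3 + 18pqr^3s^2 + 16q^4s^3 - 4q^3r^2s^2 - 192prs^4 - 128q^2s^4 + 144qr^2s^3,$$ $$L_3 = 2p^2 - 5q,$$ $$L_2 = 40qs - 16p^2s - 8rp^3 + 38rpq + 3p^2q^2 - 12q^3 - 45r^2,$$ $$L_1 = -264ps^2r - 12p^3tq^2 + 36r^3pq - 124srpq^2 + 28srp^3q + 260sptq - 132p^2qrt + 240pr^2t + 234sqr^2 + 32p^4tr + 48ptq^3 - 56sp^3t - 80q^2rt + 194qs^2p^2 - 600str - 6q^3sp^2 + 2p^2q^2r^2 - 12sr^2p^2 - 54r^4 + 320s^3 - 8q^3r^2 - 8r^3p^3 + 250qt^2 - 176q^2s^2 + 24q^4s - 36p^4s^2 - 100p^2t^2,$$ $$D_2 = 24p^2q^4s - 1100q^3rt + 800p^3qst - 1735p^2q^2rt - 3p^2qr^2s + 20pq^3rs - 600p^2rst - 1150pq^2st + 5475pqr^2t - 1380pqrs^2 + 1500qrst + 6p^3qr^3 + p^4q^2r^2 - 128p^6rt + 660pq^4t - 136p^5st - 3p^4q^3s - 236p^4qs^2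 + 337p^2q^2s^2 + 48p^5q^2t - 357p^3q^3t - 12p^4r^2s - 45pr^3s + 60q^2r^2s - 8p^2q^3r^2 - 500p^2qt^2 - 24pq^2r^3 - 1380p^3r^2t + 408p^3rs^2 - 4p^5qrs + 1028p^4qrt + 11p^3q^2rs + 36p^6s^2 + 100p^4t^2 + 9p^2r^4 - 48q^5s + 16q^4r^2 + 160q^3s^2 + 625q^2t^2 - 3375r^3t + 900r^2s^2,$$ $$M_1 = 8p^3r - 80sp^2 - 3p^2q^2 + 10prq + 200sq - 75r^2.$$ ($D$ is the discriminant of $f$; $L_3,L_2,L_1$ are factors of the leading coefficients of the remainders of degrees $3,2,1$ in the generic Sturm sequence of $f$; $D_2$ is a factor of the discriminant of the remainder of degree $2$; $M_1$ is a factor of the leading coefficient of the remainder of degree $1$ in the Sturm sequence of the remainder of degree $3$.) Then $f$ belongs to exactly one of the following twelve classes, which are described by the multiplicities of the distinct real and of the distinct non-real complex roots of $f$, and it belongs to a given class if and only if the condition stated for that class holds. 1. Five distinct real roots (all single): $L_3>0$, $L_2>0$, $L_1>0$ and $D>0$. 2. Three distinct real roots and two complex conjugate non-real roots (all single): $D<0$.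 3. One real root and four distinct non-real roots (all single): $D>0$ and ($L_3\le 0$ or $L_2\le 0$ or $L_1\le 0$). 4. One double real root and three single real roots: $D=0$ and $L_1>0$. 5. One double real root, one single real root and two single complex conjugate non-real roots: $D=0$ and $L_1<0$. 6. Two double real roots and one single real root: $D=0$, $L_1=0$, $L_2\ne 0$ and $D_2>0$. 7. Two complex conjugate non-real double roots and one single real root: $D=0$, $L_1=0$, $L_2\ne 0$ and $D_2<0$. 8. One triple real root and two single real roots: $D=0$, $L_1=0$, $L_2>0$ and $D_2=0$. 9. One triple real root and two single complex conjugate non-real roots: $D=0$, $L_1=0$, $L_2<0$ and $D_2=0$. 10. One quadruple real root and one single real root: $D=0$, $L_1=0$, $L_2=0$, $L_3\ne 0$ and $M_1=0$. 11. One triple real root and one double real root: $D=0$, $L_1=0$, $L_2=0$, $L_3\ne 0$ and $M_1\ne 0$. 12. One quintuple real root: $D=0$, $L_1=0$, $L_2=0$ and $L_3=0$. -/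

import Mathlib

open Polynomial

noncomputable section

namespace RealQuintic

/-- The monic quintic `x^5 + p x^4 + q x^3 + r x^2 + s x + t`. -/
def quintic (p q r s t : ℝ) : ℝ[X] :=
  X ^ 5 + C p * X ^ 4 + C q * X ^ 3 + C r * X ^ 2 + C s * X + C t

/-- The discriminant of the quintic, as an explicit polynomial in its coefficients. -/
def D (p q r s t : ℝ) : ℝ :=
  256*p^5*t^3 - 192*p^4*q*s*t^2 - 128*p^4*r^2*t^2 + 144*p^4*r*s^2*t + 144*p^3*q^2*r*t^2 -
  6*p^3*q^2*s^2*t - 80*p^3*q*r^2*s*t + 16*p^3*r^4*t - 27*p^2*q^4*t^2 + 18*p^2*q^3*r*s*t -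
  4*p^2*q^2*r^3*t - 1600*p^3*q*t^3 + 160*p^3*r*s*t^2 - 36*p^3*s^3*t + 1020*p^2*q^2*s*t^2 +
  560*p^2*q*r^2*t^2 - 746*p^2*q*r*s^2*t + 24*p^2*r^3*s*t - 630*p*q^3*r*t^2 + 24*p*q^3*s^2*t +
  356*p*q^2*r^2*s*t - 72*p*q*r^4*t + 108*q^5*t^2 - 72*q^4*r*s*t + 16*q^3*r^3*t +
  2000*p^2*r*t^3 - 50*p^2*s^2*t^2 + 2250*p*q^2*t^3 - 2050*p*q*r*s*t^2 + 160*p*q*s^3*t -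
  900*p*r^3*t^2 + 1020*p*r^2*s^2*t - 900*q^3*s*t^2 + 825*q^2*r^2*t^2 + 560*q^2*r*s^2*t -
  630*q*r^3*s*t - 2500*p*s*t^3 - 3750*q*r*t^3 + 2000*q*s^2*t^2 + 108*r^5*t - 27*r^4*s^2 +
  2250*r^2*s*t^2 - 1600*r*s^3*t + 256*s^5 + 3125*t^4 - 27*p^4*s^4 + 18*p^3*q*r*s^3 -
  4*p^3*r^3*s^2 - 4*p^2*q^3*s^3 + p^2*q^2*r^2*s^2 + 144*p^2*q*s^4 - 6*p^2*r^2*s^3 -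
  80*p*q^2*r*s^3 + 18*p*q*r^3*s^2 + 16*q^4*s^3 - 4*q^3*r^2*s^2 - 192*p*r*s^4 - 128*q^2*s^4 +
  144*q*r^2*s^3

/-- Factor of the leading coefficient of the degree 3 remainder in the Sturm sequence. -/
def L3 (p q : ℝ) : ℝ :=
  2*p^2 - 5*q

/-- Factor of the leading coefficient of the degree 2 remainder in the Sturm sequence. -/
def L2 (p q r s : ℝ) : ℝ :=
  40*q*s - 16*p^2*s - 8*r*p^3 + 38*r*p*q + 3*p^2*q^2 - 12*q^3 - 45*r^2

/-- Factor of the leading coefficient of the degree 1 remainder in the Sturm sequence. -/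
def L1 (p q r s t : ℝ) : ℝ :=
  -264*p*s^2*r - 12*p^3*t*q^2 + 36*r^3*p*q - 124*s*r*p*q^2 + 28*s*r*p^3*q + 260*s*p*t*q -
  132*p^2*q*r*t + 240*p*r^2*t + 234*s*q*r^2 + 32*p^4*t*r + 48*p*t*q^3 - 56*s*p^3*t -
  80*q^2*r*t + 194*q*s^2*p^2 - 600*s*t*r - 6*q^3*s*p^2 + 2*p^2*q^2*r^2 - 12*s*r^2*p^2 - 54*r^4 +
  320*s^3 - 8*q^3*r^2 - 8*r^3*p^3 + 250*q*t^2 - 176*q^2*s^2 + 24*q^4*s - 36*p^4*s^2 -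
  100*p^2*t^2

/-- Factor of the discriminant of the degree 2 remainder in the Sturm sequence. -/
def D2 (p q r s t : ℝ) : ℝ :=
  24*p^2*q^4*s - 1100*q^3*r*t + 800*p^3*q*s*t - 1735*p^2*q^2*r*t - 3*p^2*q*r^2*s +
  20*p*q^3*r*s - 600*p^2*r*s*t - 1150*p*q^2*s*t + 5475*p*q*r^2*t - 1380*p*q*r*s^2 +
  1500*q*r*s*t + 6*p^3*q*r^3 + p^4*q^2*r^2 - 128*p^6*r*t + 660*p*q^4*t - 136*p^5*s*t -
  3*p^4*q^3*s - 236*p^4*q*s^2 + 337*p^2*q^2*s^2 + 48*p^5*q^2*t - 357*p^3*q^3*t - 12*p^4*r^2*s -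
  45*p*r^3*s + 60*q^2*r^2*s - 8*p^2*q^3*r^2 - 500*p^2*q*t^2 - 24*p*q^2*r^3 - 1380*p^3*r^2*t +
  408*p^3*r*s^2 - 4*p^5*q*r*s + 1028*p^4*q*r*t + 11*p^3*q^2*r*s + 36*p^6*s^2 + 100*p^4*t^2 +
  9*p^2*r^4 - 48*q^5*s + 16*q^4*r^2 + 160*q^3*s^2 + 625*q^2*t^2 - 3375*r^3*t + 900*r^2*s^2

/-- Factor of the leading coefficient of the degree 1 remainder in the Sturm sequence of the
degree 3 remainder. -/
def M1 (p q r s : ℝ) : ℝ :=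
  8*p^3*r - 80*s*p^2 - 3*p^2*q^2 + 10*p*r*q + 200*s*q - 75*r^2

/-- The multiset of the multiplicities of the distinct real roots of `f`. -/
def realMultiplicities (f : ℝ[X]) : Multiset ℕ :=
  f.roots.toFinset.val.map fun x => f.rootMultiplicity x

/-- The multiset of the multiplicities of the distinct non-real complex roots of `f`. -/
def nonrealMultiplicities (f : ℝ[X]) : Multiset ℕ :=
  ((f.map (algebraMap ℝ ℂ)).roots.toFinset.filter fun z => z.im ≠ 0).val.map
    fun z => (f.map (algebraMap ℝ ℂ)).rootMultiplicity z

/-- The twelve classes of real quintics according to their real and complex root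
multiplicities. -/
inductive RootClass where
  /-- 5 distinct real roots -/
  | fiveReal
  /-- 3 distinct real roots and 2 complex conjugate roots -/
  | threeReal
  /-- 1 real root and 4 distinct complex single roots -/
  | oneReal
  /-- 1 double real root and 3 single real roots -/
  | doubleThreeSingle
  /-- 1 double real root, 1 single real root and 2 complex conjugate roots -/
  | doubleSingleConj
  /-- 2 real double roots and 1 real single root -/
  | twoDoubleSingle
  /-- 2 complex conjugate double roots and 1 single real root -/
  | conjDoubleSingle
  /-- 1 triple root and 2 single real roots -/
  | tripleTwoSingle
  /-- 1 triple root and 2 complex conjugate roots -/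
  | tripleConj
  /-- 1 quadruple root and 1 single root (both are real) -/
  | quadrupleSingle
  /-- 1 triple root and 1 double root (both are real) -/
  | tripleDouble
  /-- 1 quintuple root (which is real) -/
  | quintuple

/-- The multiplicities of the distinct real roots in each class. -/
def RootClass.real : RootClass → Multiset ℕ
  | fiveReal => {1, 1, 1, 1, 1}
  | threeReal => {1, 1, 1}
  | oneReal => {1}
  | doubleThreeSingle => {2, 1, 1, 1}
  | doubleSingleConj => {2, 1}
  | twoDoubleSingle => {2, 2, 1}
  | conjDoubleSingle => {1}
  | tripleTwoSingle => {3, 1, 1}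
  | tripleConj => {3}
  | quadrupleSingle => {4, 1}
  | tripleDouble => {3, 2}
  | quintuple => {5}

/-- The multiplicities of the distinct non-real roots in each class. (The non-real roots of a
real polynomial come in conjugate pairs of equal multiplicity.) -/
def RootClass.nonreal : RootClass → Multiset ℕ
  | fiveReal => 0
  | threeReal => {1, 1}
  | oneReal => {1, 1, 1, 1}
  | doubleThreeSingle => 0
  | doubleSingleConj => {1, 1}
  | twoDoubleSingle => 0
  | conjDoubleSingle => {2, 2}
  | tripleTwoSingle => 0
  | tripleConj => {1, 1}
  | quadrupleSingle => 0
  | tripleDouble => 0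
  | quintuple => 0

/-- The polynomial `f` belongs to the class `c`. -/
def RootClass.Contains (c : RootClass) (f : ℝ[X]) : Prop :=
  realMultiplicities f = c.real ∧ nonrealMultiplicities f = c.nonreal

end RealQuintic

end

namespace RealQuintic

/-! ### Translation to a root at the origin -/

/-! No Sturm sequence is computed. The twelve classes are pairwise disjoint and the twelve
conditions are mutually exclusive, so both directions of every equivalence follow once each quintic
is shown to lie in some class whose condition it satisfies (`isClassified`). Over ℝ the quintic
splits into linear factors and quadratics with conjugate roots (`exists_factorization`), which
leaves finitely many root patterns. All the invariants are unchanged by translation, so a real root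
can be moved to the origin (`invariants_of_factorization`); their signs are then read off from
polynomial identities in the remaining roots. The one case where an identity does not suffice is
that of two distinct conjugate pairs. There `2 * L3`, `L2` and `L1` are leading principal minors of
the Hankel matrix of power sums, the matrix of the Hermite form. If all were positive, so would be
the form, but it is nonpositive at some nonzero vector (`not_all_pos_of_two_conj_pairs`). -/

theorem L3_translate (p q h : ℝ) : L3 (p + 5*h) (q + 4*p*h + 10*h^2) = L3 p q := by
  simp only [L3]
  ring

theorem L2_translate (p q r s h : ℝ) :
    L2 (p + 5*h) (q + 4*p*h + 10*h^2) (r + 3*q*h + 6*p*h^2 + 10*h^3)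
      (s + 2*r*h + 3*q*h^2 + 4*p*h^3 + 5*h^4) = L2 p q r s := by
  simp only [L2]
  ring

theorem M1_translate (p q r s h : ℝ) :
    M1 (p + 5*h) (q + 4*p*h + 10*h^2) (r + 3*q*h + 6*p*h^2 + 10*h^3)
      (s + 2*r*h + 3*q*h^2 + 4*p*h^3 + 5*h^4) = M1 p q r s := by
  simp only [M1]
  ring

/-- The arguments on the left are the coefficients of the depressed quintic whose roots are `5 * x +
p` for the roots `x` of the original. The exponent of 5 is the weight of the invariant as a
polynomial in the roots: 12 here, then 14 for `D2` and 20 for `D`. -/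
theorem L1_depressed (p q r s t : ℝ) :
    L1 0 (25*q - 10*p^2) (125*r - 75*p*q + 20*p^3)
      (625*s - 250*p*r + 75*p^2*q - 15*p^4)
      (3125*t - 625*p*s + 125*p^2*r - 25*p^3*q + 4*p^5) = 5^12 * L1 p q r s t := by
  simp only [L1]
  ring

theorem D2_depressed (p q r s t : ℝ) :
    D2 0 (25*q - 10*p^2) (125*r - 75*p*q + 20*p^3)
      (625*s - 250*p*r + 75*p^2*q - 15*p^4)
      (3125*t - 625*p*s + 125*p^2*r - 25*p^3*q + 4*p^5) = 5^14 * D2 p q r s t := by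
  simp only [D2]
  ring

theorem D_depressed (p q r s t : ℝ) :
    D 0 (25*q - 10*p^2) (125*r - 75*p*q + 20*p^3)
      (625*s - 250*p*r + 75*p^2*q - 15*p^4)
      (3125*t - 625*p*s + 125*p^2*r - 25*p^3*q + 4*p^5) = 5^20 * D p q r s t := by
  simp only [D]
  ring

/-- A quintic and its translate have the same depressed form, so the identity reduces to
`L1_depressed` on both sides. -/
theorem L1_translate (p q r s t h : ℝ) :
    L1 (p + 5*h) (q + 4*p*h + 10*h^2) (r + 3*q*h + 6*p*h^2 + 10*h^3)
      (s + 2*r*h + 3*q*h^2 + 4*p*h^3 + 5*h^4) (t + s*h + r*h^2 + q*h^3 + p*h^4 + h^5) =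
      L1 p q r s t := by
  refine mul_left_cancel₀ (pow_ne_zero 12 (by norm_num : (5 : ℝ) ≠ 0)) ?_
  rw [← L1_depressed, ← L1_depressed p]
  congr 1 <;> ring

theorem D2_translate (p q r s t h : ℝ) :
    D2 (p + 5*h) (q + 4*p*h + 10*h^2) (r + 3*q*h + 6*p*h^2 + 10*h^3)
      (s + 2*r*h + 3*q*h^2 + 4*p*h^3 + 5*h^4) (t + s*h + r*h^2 + q*h^3 + p*h^4 + h^5) =
      D2 p q r s t := by
  refine mul_left_cancel₀ (pow_ne_zero 14 (by norm_num : (5 : ℝ) ≠ 0)) ?_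
  rw [← D2_depressed, ← D2_depressed p]
  congr 1 <;> ring

theorem D_translate (p q r s t h : ℝ) :
    D (p + 5*h) (q + 4*p*h + 10*h^2) (r + 3*q*h + 6*p*h^2 + 10*h^3)
      (s + 2*r*h + 3*q*h^2 + 4*p*h^3 + 5*h^4) (t + s*h + r*h^2 + q*h^3 + p*h^4 + h^5) =
      D p q r s t := by
  refine mul_left_cancel₀ (pow_ne_zero 20 (by norm_num : (5 : ℝ) ≠ 0)) ?_
  rw [← D_depressed, ← D_depressed p]
  congr 1 <;> ring

theorem quintic_injective {p q r s t p' q' r' s' t' : ℝ}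
    (h : quintic p q r s t = quintic p' q' r' s' t') :
    p = p' ∧ q = q' ∧ r = r' ∧ s = s' ∧ t = t' := by
  have key (i : ℕ) : (quintic p q r s t).coeff i = (quintic p' q' r' s' t').coeff i := by rw [h]
  have h0 := key 0
  have h1 := key 1
  have h2 := key 2
  have h3 := key 3
  have h4 := key 4
  simp [quintic, coeff_X, coeff_C, coeff_X_pow] at h0 h1 h2 h3 h4
  exact ⟨h4, h3, h2, h1, h0⟩

/-- All the invariants of `(x - a) (y ^ 2 + b y + c) (y ^ 2 + d y + e)`, where `y = x - a`,
are those of `y (y ^ 2 + b y + c) (y ^ 2 + d y + e)`. -/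
theorem invariants_of_factorization {p q r s t a b c d e : ℝ}
    (h : quintic p q r s t = (X - C a) * ((X - C a)^2 + C b * (X - C a) + C c) *
      ((X - C a)^2 + C d * (X - C a) + C e)) :
    D p q r s t = D (b + d) (c + b*d + e) (b*e + c*d) (c*e) 0 ∧
    L1 p q r s t = L1 (b + d) (c + b*d + e) (b*e + c*d) (c*e) 0 ∧
    L2 p q r s = L2 (b + d) (c + b*d + e) (b*e + c*d) (c*e) ∧
    L3 p q = L3 (b + d) (c + b*d + e) ∧
    D2 p q r s t = D2 (b + d) (c + b*d + e) (b*e + c*d) (c*e) 0 ∧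
    M1 p q r s = M1 (b + d) (c + b*d + e) (b*e + c*d) (c*e) := by
  generalize hP : b + d = P
  generalize hQ : c + b*d + e = Q
  generalize hR : b*e + c*d = R
  generalize hS : c*e = S
  -- If `g` has coefficients `P, Q, R, S, 0`, the quintic is `g (x - a)`, that is, `g` translated by
  -- `-a`.
  have h' : quintic p q r s t = quintic (P + 5*(-a)) (Q + 4*P*(-a) + 10*(-a)^2)
      (R + 3*Q*(-a) + 6*P*(-a)^2 + 10*(-a)^3)
      (S + 2*R*(-a) + 3*Q*(-a)^2 + 4*P*(-a)^3 + 5*(-a)^4)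
      (0 + S*(-a) + R*(-a)^2 + Q*(-a)^3 + P*(-a)^4 + (-a)^5) := by
    rw [h, quintic]
    subst hP hQ hR hS
    simp only [map_zero, map_add, map_mul, map_neg, map_pow, map_ofNat]
    ring
  obtain ⟨rfl, rfl, rfl, rfl, rfl⟩ := quintic_injective h'
  exact ⟨D_translate .., L1_translate .., L2_translate .., L3_translate .., D2_translate ..,
    M1_translate ..⟩

/-! ### Values of the invariants for a quintic with root zero -/

/-- Multiplicativity of the discriminant: the last factor is the squared resultant of the two
quadratics, and `c * e` is the product of their resultants with `y`, up to sign. -/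
theorem D_of_quadratic_factors (b c d e : ℝ) :
    D (b + d) (c + b*d + e) (b*e + c*d) (c*e) 0 =
      (c*e)^2 * (b^2 - 4*c) * (d^2 - 4*e) * ((c - e)^2 + (b - d)*(b*e - c*d))^2 := by
  simp only [D]
  ring

/-- The roots are 0 twice, `-b`, and those of `y ^ 2 + d y + e`; the factor `b^2 - b*d + e` is the
value of that quadratic at `-b`. The sign is that of `d^2 - 4*e` unless a further coincidence
occurs. -/
theorem L1_of_double_root (b d e : ℝ) :
    L1 (b + d) (0 + b*d + e) (b*e + 0*d) (0*e) 0 =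
      2 * (b*e*(b^2 - b*d + e))^2 * (d^2 - 4*e) := by
  simp only [L1]
  ring

/-- Here the simple root is at the origin and `y ^ 2 + d y + e` carries both double roots, real or
not, so these identities serve two classes at once. -/
theorem L1_of_two_double_roots (d e : ℝ) :
    L1 (d + d) (e + d*d + e) (d*e + e*d) (e*e) 0 = 0 := by
  simp only [L1]
  ring

theorem L2_of_two_double_roots (d e : ℝ) :
    L2 (d + d) (e + d*d + e) (d*e + e*d) (e*e) = 4 * e^2 * (d^2 - 4*e) := by
  simp only [L2]
  ring

theorem D2_of_two_double_roots (d e : ℝ) :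
    D2 (d + d) (e + d*d + e) (d*e + e*d) (e*e) 0 = 4 * e^4 * (d^2 - 4*e)^3 := by
  simp only [D2]
  ring

theorem L2_of_triple_root (d e : ℝ) :
    L2 (0 + d) (0 + 0*d + e) (0*e + 0*d) (0*e) = 3 * e^2 * (d^2 - 4*e) := by
  simp only [L2]
  ring

theorem D2_of_triple_root (d e : ℝ) :
    D2 (0 + d) (0 + 0*d + e) (0*e + 0*d) (0*e) 0 = 0 := by
  simp only [D2]
  ring

/-- By Cauchy–Binet, the Hankel minor of order 4 is the sum of squared Vandermonde products over the
4-subsets of the roots 0, `x`, `y`, `z`, `w`. The next two identities are the same for 3-subsets and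
2-subsets. -/
theorem L1_of_five_roots (x y z w : ℝ) :
    L1 (-(x + y) + -(z + w)) (x*y + -(x + y)*(-(z + w)) + z*w)
      (-(x + y)*(z*w) + x*y*(-(z + w))) (x*y*(z*w)) 0 =
    (x*y*z)^2 * ((x - y)*(x - z)*(y - z))^2 + (x*y*w)^2 * ((x - y)*(x - w)*(y - w))^2 +
    (x*z*w)^2 * ((x - z)*(x - w)*(z - w))^2 + (y*z*w)^2 * ((y - z)*(y - w)*(z - w))^2 +
    ((x - y)*(x - z)*(x - w)*(y - z)*(y - w)*(z - w))^2 := by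
  simp only [L1]
  ring

theorem L2_of_five_roots (x y z w : ℝ) :
    L2 (-(x + y) + -(z + w)) (x*y + -(x + y)*(-(z + w)) + z*w)
      (-(x + y)*(z*w) + x*y*(-(z + w))) (x*y*(z*w)) =
    (x*y*(x - y))^2 + (x*z*(x - z))^2 + (x*w*(x - w))^2 + (y*z*(y - z))^2 + (y*w*(y - w))^2 +
    (z*w*(z - w))^2 + ((x - y)*(x - z)*(y - z))^2 + ((x - y)*(x - w)*(y - w))^2 +
    ((x - z)*(x - w)*(z - w))^2 + ((y - z)*(y - w)*(z - w))^2 := by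
  simp only [L2]
  ring

theorem two_mul_L3_of_five_roots (x y z w : ℝ) :
    2 * L3 (-(x + y) + -(z + w)) (x*y + -(x + y)*(-(z + w)) + z*w) =
    x^2 + y^2 + z^2 + w^2 + (x - y)^2 + (x - z)^2 + (x - w)^2 + (y - z)^2 + (y - w)^2 +
    (z - w)^2 := by
  simp only [L3]
  ring

/-! ### Two conjugate pairs: the Hermite form is not positive definite -/

theorem quadraticForm_two_pos {a b c x y : ℝ} (ha : 0 < a) (h : 0 < a*c - b^2)
    (hxy : x ≠ 0 ∨ y ≠ 0) : 0 < a*x^2 + 2*b*x*y + c*y^2 := by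
  have key : a * (a*x^2 + 2*b*x*y + c*y^2) = (a*x + b*y)^2 + (a*c - b^2)*y^2 := by ring
  refine pos_of_mul_pos_right (b := _) (a := a) ?_ ha.le
  rw [key]
  by_cases hy : y = 0
  · subst hy
    have : x ≠ 0 := by simpa using hxy
    have : 0 < (a*x + b*0)^2 := by simp; positivity
    simpa using this
  · have : 0 < y^2 := by positivity
    have := mul_pos h this
    positivity

/-- Sylvester's criterion by completing the square: `a` times the form is a square plus a binary
form whose determinant is `a` times the ternary one. -/
theorem quadraticForm_three_pos {a b c d e f x y z : ℝ} (ha : 0 < a) (h2 : 0 < a*d - b^2)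
    (h3 : 0 < a*d*f + 2*b*c*e - a*e^2 - b^2*f - c^2*d) (hxyz : x ≠ 0 ∨ y ≠ 0 ∨ z ≠ 0) :
    0 < a*x^2 + d*y^2 + f*z^2 + 2*b*x*y + 2*c*x*z + 2*e*y*z := by
  refine pos_of_mul_pos_right (b := _) (a := a) ?_ ha.le
  have key : a * (a*x^2 + d*y^2 + f*z^2 + 2*b*x*y + 2*c*x*z + 2*e*y*z) =
      (a*x + b*y + c*z)^2 +
        ((a*d - b^2)*y^2 + 2*(a*e - b*c)*y*z + (a*f - c^2)*z^2) := by ring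
  rw [key]
  by_cases hyz : y ≠ 0 ∨ z ≠ 0
  · have := quadraticForm_two_pos (b := a*e - b*c) (c := a*f - c^2) h2
      (by have := mul_pos ha h3; linarith) hyz
    positivity
  · obtain ⟨rfl, rfl⟩ : y = 0 ∧ z = 0 := by simpa using hyz
    have : x ≠ 0 := by simpa using hxyz
    have : 0 < (a*x)^2 := by positivity
    simpa using this

/-- A form with positive leading principal minors is positive on the last three coordinates. -/
theorem quadraticForm_restrict_pos {a b c d e f g h i j x y z : ℝ} (ha : 0 < a)
    (h2 : 0 < a*e - b^2)
    (h3 : 0 < a*e*h + 2*b*c*f - a*f^2 - b^2*h - c^2*e)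
    (h4 : 0 < (a*e - b^2)*(a*h - c^2)*(a*j - d^2) + 2*(a*f - b*c)*(a*g - b*d)*(a*i - c*d) -
      (a*e - b^2)*(a*i - c*d)^2 - (a*f - b*c)^2*(a*j - d^2) - (a*g - b*d)^2*(a*h - c^2))
    (hxyz : x ≠ 0 ∨ y ≠ 0 ∨ z ≠ 0) :
    0 < e*x^2 + h*y^2 + j*z^2 + 2*f*x*y + 2*g*x*z + 2*i*y*z := by
  refine pos_of_mul_pos_right (b := _) (a := a) ?_ ha.le
  -- Schur complement of `a`, scaled by `a`. Its determinant, the quantity in `h4`, is `a ^ 2` times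
  -- the 4×4 determinant.
  have := quadraticForm_three_pos (d := a*h - c^2) (f := a*j - d^2) (b := a*f - b*c)
    (c := a*g - b*d) (e := a*i - c*d) h2 (by have := mul_pos ha h3; linarith) h4 hxyz
  have key : a * (e*x^2 + h*y^2 + j*z^2 + 2*f*x*y + 2*g*x*z + 2*i*y*z) =
      (b*x + c*y + d*z)^2 + ((a*e - b^2)*x^2 + (a*h - c^2)*y^2 + (a*j - d^2)*z^2 +
        2*(a*f - b*c)*x*y + 2*(a*g - b*d)*x*z + 2*(a*i - c*d)*y*z) := by ring
  rw [key]
  positivity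

theorem exists_ne_zero_orthogonal (α β : Fin 3 → ℝ) :
    ∃ x y z : ℝ, (x ≠ 0 ∨ y ≠ 0 ∨ z ≠ 0) ∧ α 0*x + α 1*y + α 2*z = 0 ∧
      β 0*x + β 1*y + β 2*z = 0 := by
  obtain ⟨v, hv, hv'⟩ := (Matrix.exists_mulVec_eq_zero_iff (M := Matrix.of ![α, β, 0])).2
    (by simp [Matrix.det_fin_three])
  refine ⟨v 0, v 1, v 2, ?_, ?_, ?_⟩
  · by_contra! hc
    exact hv (by ext i; fin_cases i <;> simp [hc])
  · simpa [Matrix.mulVec, dotProduct, Fin.sum_univ_three] using congrFun hv' 0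
  · simpa [Matrix.mulVec, dotProduct, Fin.sum_univ_three] using congrFun hv' 1

/-- The Hermite form sends a real cubic `g` to the sum of `g(ρ)^2` over the roots `ρ`, here 0, `u ±
iv`, `w ± iz`. Requiring `g(0) = 0` and `g` purely imaginary at `u + iv` and `w + iz` leaves a
nonzero `g`, at which every term is at most 0. -/
theorem not_all_pos_of_two_conj_pairs (u v w z : ℝ) :
    L3 (-2*u + -2*w) (u^2 + v^2 + (-2*u)*(-2*w) + (w^2 + z^2)) ≤ 0 ∨
    L2 (-2*u + -2*w) (u^2 + v^2 + (-2*u)*(-2*w) + (w^2 + z^2))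
      ((-2*u)*(w^2 + z^2) + (u^2 + v^2)*(-2*w)) ((u^2 + v^2)*(w^2 + z^2)) ≤ 0 ∨
    L1 (-2*u + -2*w) (u^2 + v^2 + (-2*u)*(-2*w) + (w^2 + z^2))
      ((-2*u)*(w^2 + z^2) + (u^2 + v^2)*(-2*w)) ((u^2 + v^2)*(w^2 + z^2)) 0 ≤ 0 := by
  by_contra! hc
  obtain ⟨h3, h2, h1⟩ := hc
  -- For `g = x ρ + y ρ^2 + k ρ^3`, the two vectors give the real parts of `g` at `u + iv` and at `w
  -- + iz`.
  obtain ⟨x, y, k, hne, hu, hw⟩ := exists_ne_zero_orthogonal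
    ![u, u^2 - v^2, u^3 - 3*u*v^2] ![w, w^2 - z^2, w^3 - 3*w*z^2]
  simp only [Matrix.cons_val] at hu hw
  -- `s1`, ..., `s6` are the power sums of the roots; the zero root contributes only to the sum of
  -- order 0, which is 5.
  obtain ⟨s1, e1⟩ : ∃ s, s = 2*(u + w) := ⟨_, rfl⟩
  obtain ⟨s2, e2⟩ : ∃ s, s = 2*(u^2 - v^2 + (w^2 - z^2)) := ⟨_, rfl⟩
  obtain ⟨s3, e3⟩ : ∃ s, s = 2*(u^3 - 3*u*v^2 + (w^3 - 3*w*z^2)) := ⟨_, rfl⟩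
  obtain ⟨s4, e4⟩ : ∃ s, s = 2*(u^4 - 6*u^2*v^2 + v^4 + (w^4 - 6*w^2*z^2 + z^4)) := ⟨_, rfl⟩
  obtain ⟨s5, e5⟩ : ∃ s, s = 2*(u^5 - 10*u^3*v^2 + 5*u*v^4 + (w^5 - 10*w^3*z^2 + 5*w*z^4)) :=
    ⟨_, rfl⟩
  obtain ⟨s6, e6⟩ : ∃ s, s = 2*(u^6 - 15*u^4*v^2 + 15*u^2*v^4 - v^6 +
    (w^6 - 15*w^4*z^2 + 15*w^2*z^4 - z^6)) := ⟨_, rfl⟩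
  have m2 : 0 < 5*s2 - s1^2 := by
    refine (mul_pos two_pos h3).trans_eq ?_
    subst e1 e2
    simp only [L3]
    ring
  have m3 : 0 < 5*s2*s4 + 2*s1*s2*s3 - 5*s3^2 - s1^2*s4 - s2^2*s2 := by
    refine h2.trans_eq ?_
    subst e1 e2 e3 e4
    simp only [L2]
    ring
  have m4 : 0 < (5*s2 - s1^2)*(5*s4 - s2^2)*(5*s6 - s3^2) +
      2*(5*s3 - s1*s2)*(5*s4 - s1*s3)*(5*s5 - s2*s3) -
      (5*s2 - s1^2)*(5*s5 - s2*s3)^2 - (5*s3 - s1*s2)^2*(5*s6 - s3^2) -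
      (5*s4 - s1*s3)^2*(5*s4 - s2^2) := by
    -- 25 is the factor `a ^ 2` of the scaled Schur complement, with `a = 5`.
    refine (mul_pos (show (0 : ℝ) < 25 by norm_num) h1).trans_eq ?_
    subst e1 e2 e3 e4 e5 e6
    simp only [L1]
    ring
  have pos := quadraticForm_restrict_pos (by norm_num) m2 m3 m4 hne
  have neg : s2*x^2 + s4*y^2 + s6*k^2 + 2*s3*x*y + 2*s4*x*k + 2*s5*y*k =
      2*(u*x + (u^2 - v^2)*y + (u^3 - 3*u*v^2)*k)^2 -
      2*(v*x + 2*u*v*y + (3*u^2*v - v^3)*k)^2 +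
      2*(w*x + (w^2 - z^2)*y + (w^3 - 3*w*z^2)*k)^2 -
      2*(z*x + 2*w*z*y + (3*w^2*z - z^3)*k)^2 := by
    subst e2 e3 e4 e5 e6
    ring
  rw [neg, hu, hw] at pos
  have aux (A B : ℝ) : 2*0^2 - 2*A^2 + 2*0^2 - 2*B^2 ≤ 0 := by
    linarith [sq_nonneg A, sq_nonneg B]
  exact (aux _ _).not_gt pos

/-! ### Factorization of real polynomials -/

/-- The monic quadratic with roots `u + v i` and `u - v i`, for `w = (u, v)`. -/
noncomputable def conjQuadratic (w : ℝ × ℝ) : ℝ[X] := (X - C w.1)^2 + C (w.2^2)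

theorem monic_conjQuadratic (w : ℝ × ℝ) : (conjQuadratic w).Monic := by
  unfold conjQuadratic
  monicity!

theorem natDegree_conjQuadratic (w : ℝ × ℝ) : (conjQuadratic w).natDegree = 2 := by
  unfold conjQuadratic
  compute_degree!

theorem map_conjQuadratic (w : ℝ × ℝ) :
    (conjQuadratic w).map (algebraMap ℝ ℂ) = (X - C ⟨w.1, w.2⟩) * (X - C ⟨w.1, -w.2⟩) := by
  have h1 : (⟨w.1, w.2⟩ : ℂ) = w.1 + w.2 * Complex.I := by simp [Complex.ext_iff]
  have h2 : (⟨w.1, -w.2⟩ : ℂ) = w.1 - w.2 * Complex.I := by simp [Complex.ext_iff]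
  have hI : (C Complex.I : ℂ[X])^2 = -1 := by
    rw [← C_pow, Complex.I_sq]
    simp
  simp only [conjQuadratic, h1, h2, Polynomial.map_add, Polynomial.map_sub, Polynomial.map_pow,
    map_X, map_C, map_add, map_sub, map_mul, map_pow, Complex.coe_algebraMap]
  linear_combination (C (w.2 : ℂ)^2) * hI

/-- Strong induction on the degree, splitting off a complex root, together with its conjugate when
it is not real. Normalizing the imaginary part to be positive makes the pair `w` unique, so equality
of conjugate root pairs is equality of the `w`. -/
theorem exists_factorization (n : ℕ) (f : ℝ[X]) (hf : f.Monic) (hn : f.natDegree = n) :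
    ∃ (R : Multiset ℝ) (Q : Multiset (ℝ × ℝ)), (∀ w ∈ Q, 0 < w.2) ∧
      f = (R.map fun a => X - C a).prod * (Q.map conjQuadratic).prod := by
  induction n using Nat.strong_induction_on generalizing f with
  | _ n ih =>
    rcases Nat.eq_zero_or_pos n with rfl | hpos
    · exact ⟨0, 0, by simp, by simpa using hf.natDegree_eq_zero.1 hn⟩
    have hdeg : (f.map (algebraMap ℝ ℂ)).degree ≠ 0 := by
      rw [degree_map, degree_eq_natDegree hf.ne_zero, hn]
      exact_mod_cast hpos.ne'
    obtain ⟨z, hz⟩ := IsAlgClosed.exists_root _ hdeg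
    by_cases him : z.im = 0
    · have hroot : f.IsRoot z.re := by
        have hzre : z = algebraMap ℝ ℂ z.re := by simp [Complex.ext_iff, him]
        rw [hzre] at hz
        exact IsRoot.of_map (f := algebraMap ℝ ℂ) hz (algebraMap ℝ ℂ).injective
      obtain ⟨g, hg⟩ := dvd_iff_isRoot.2 hroot
      have hgm : g.Monic := (monic_X_sub_C z.re).of_mul_monic_left (hg ▸ hf)
      have hgd : g.natDegree + 1 = n := by
        rw [← hn, hg, (monic_X_sub_C _).natDegree_mul hgm, natDegree_X_sub_C, add_comm]
      obtain ⟨R, Q, hQ, rfl⟩ := ih _ (by omega) g hgm rfl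
      exact ⟨z.re ::ₘ R, Q, hQ, by rw [hg, Multiset.map_cons, Multiset.prod_cons, mul_assoc]⟩
    · have haev : aeval z f = 0 := by rwa [IsRoot, eval_map_algebraMap] at hz
      have hdvd : conjQuadratic (z.re, |z.im|) ∣ f := by
        convert f.quadratic_dvd_of_aeval_eq_zero_im_ne_zero haev him using 1
        rw [conjQuadratic, sq_abs, Complex.sq_norm, Complex.normSq_apply]
        simp only [map_add, map_mul, map_pow, map_ofNat]
        ring
      obtain ⟨g, hg⟩ := hdvd
      have hgm : g.Monic := (monic_conjQuadratic _).of_mul_monic_left (hg ▸ hf)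
      have hgd : g.natDegree + 2 = n := by
        rw [← hn, hg, (monic_conjQuadratic _).natDegree_mul hgm, natDegree_conjQuadratic, add_comm]
      obtain ⟨R, Q, hQ, rfl⟩ := ih _ (by omega) g hgm rfl
      refine ⟨R, (z.re, |z.im|) ::ₘ Q, ?_, ?_⟩
      · simpa [him] using hQ
      · rw [hg, Multiset.map_cons, Multiset.prod_cons]
        ring

theorem natDegree_factorization (R : Multiset ℝ) (Q : Multiset (ℝ × ℝ)) :
    ((R.map fun a => X - C a).prod * (Q.map conjQuadratic).prod).natDegree =
      R.card + 2 * Q.card := by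
  have h1 : (R.map fun a => X - C a).prod.Monic :=
    monic_multiset_prod_of_monic _ _ fun a _ => monic_X_sub_C a
  have h2 : (Q.map conjQuadratic).prod.Monic :=
    monic_multiset_prod_of_monic _ _ fun a _ => monic_conjQuadratic a
  rw [h1.natDegree_mul h2, natDegree_multiset_prod_of_monic, natDegree_multiset_prod_of_monic]
  · simp [natDegree_conjQuadratic, mul_comm]
  · rintro _ h
    obtain ⟨w, -, rfl⟩ := Multiset.mem_map.1 h
    exact monic_conjQuadratic w
  · simpa using fun a _ => monic_X_sub_C _

/-! ### Multiplicities from a factorization -/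

/-- The multiset of the multiplicities of the distinct elements. -/
def multiplicities {α : Type*} [DecidableEq α] (m : Multiset α) : Multiset ℕ :=
  m.dedup.map fun x => m.count x

-- Elements of `N` are non-real and the images of `R` are real, so the counts in the sum do not
-- interfere.
open Classical in
theorem multiplicities_of_roots {f : ℝ[X]} (R : Multiset ℝ) (N : Multiset ℂ)
    (hN : ∀ z ∈ N, z.im ≠ 0)
    (hf : (f.map (algebraMap ℝ ℂ)).roots = R.map (algebraMap ℝ ℂ) + N) :
    realMultiplicities f = multiplicities R ∧ nonrealMultiplicities f = multiplicities N := by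
  have hcount (x : ℝ) : f.rootMultiplicity x = R.count x := by
    have h0 : N.count (algebraMap ℝ ℂ x) = 0 :=
      Multiset.count_eq_zero.2 fun h => hN _ h (by simp)
    rw [eq_rootMultiplicity_map (algebraMap ℝ ℂ).injective, ← count_roots, hf, Multiset.count_add,
      Multiset.count_map_eq_count' _ _ (algebraMap ℝ ℂ).injective, h0, add_zero]
  have hcount' (z : ℂ) (hz : z.im ≠ 0) :
      (f.map (algebraMap ℝ ℂ)).rootMultiplicity z = N.count z := by
    rw [← count_roots, hf, Multiset.count_add, Multiset.count_eq_zero.2, zero_add]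
    rw [Multiset.mem_map]
    rintro ⟨x, -, rfl⟩
    exact hz (by simp)
  have hroots : f.roots = R := by
    ext x
    rw [count_roots, hcount]
  constructor
  · simp only [realMultiplicities, multiplicities, hroots, hcount]
    congr!
  · have hfin : (f.map (algebraMap ℝ ℂ)).roots.toFinset.filter (fun z => z.im ≠ 0) =
        N.toFinset := by
      ext z
      simp only [Finset.mem_filter, Multiset.mem_toFinset, hf, Multiset.mem_add, Multiset.mem_map]
      constructor
      · rintro ⟨⟨x, -, rfl⟩ | h, hz⟩
        · simp at hz
        · exact h
      · exact fun h => ⟨Or.inr h, hN z h⟩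
    have heq : nonrealMultiplicities f = N.toFinset.val.map
        fun z => (f.map (algebraMap ℝ ℂ)).rootMultiplicity z := by
      rw [← hfin, nonrealMultiplicities]
    rw [heq, multiplicities, Multiset.toFinset_val]
    exact Multiset.map_congr rfl fun z hz => hcount' z (hN z (Multiset.mem_dedup.1 hz))

/-- The two roots of `conjQuadratic w`. -/
def conjRoots (w : ℝ × ℝ) : Multiset ℂ := {⟨w.1, w.2⟩, ⟨w.1, -w.2⟩}

open Classical in
theorem multiplicities_of_factorization {f : ℝ[X]} (R : Multiset ℝ) (Q : Multiset (ℝ × ℝ))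
    (hQ : ∀ w ∈ Q, 0 < w.2)
    (hf : f = (R.map fun a => X - C a).prod * (Q.map conjQuadratic).prod) :
    realMultiplicities f = multiplicities R ∧
      nonrealMultiplicities f = multiplicities (Q.bind conjRoots) := by
  apply multiplicities_of_roots
  · simp only [Multiset.mem_bind, conjRoots]
    rintro z ⟨w, hw, hz⟩
    have := (hQ w hw).ne'
    rcases (by simpa using hz : z = _ ∨ z = _) with rfl | rfl <;> simpa
  · have : f.map (algebraMap ℝ ℂ) =
        ((R.map (algebraMap ℝ ℂ) + Q.bind conjRoots).map fun z => X - C z).prod := by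
      rw [hf, Polynomial.map_mul, Polynomial.map_multiset_prod, Polynomial.map_multiset_prod,
        Multiset.map_add, Multiset.prod_add, Multiset.map_bind, Multiset.prod_bind]
      simp only [Multiset.map_map, Function.comp_def, map_conjQuadratic, conjRoots]
      simp
    rw [this, roots_multiset_prod_X_sub_C]

theorem multiplicities_replicate_add {α : Type*} [DecidableEq α] {a : α} {m : Multiset α} (k : ℕ)
    (h : a ∉ m) :
    multiplicities (Multiset.replicate (k + 1) a + m) = (k + 1) ::ₘ multiplicities m := by
  have hd : (Multiset.replicate (k + 1) a + m).dedup = a ::ₘ m.dedup := by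
    induction k with
    | zero => simp [Multiset.dedup_cons_of_notMem h]
    | succ k ih =>
      rw [Multiset.replicate_succ, Multiset.cons_add, Multiset.dedup_cons_of_mem (by simp), ih]
  rw [multiplicities, hd, Multiset.map_cons, multiplicities]
  congr 1
  · simp [Multiset.count_eq_zero.2 h]
  · refine Multiset.map_congr rfl fun x hx => ?_
    have : a ≠ x := by
      rintro rfl
      exact h (Multiset.mem_dedup.1 hx)
    rw [Multiset.count_add, Multiset.count_replicate, if_neg this, zero_add]

theorem multiplicities_cons {α : Type*} [DecidableEq α] {a : α} {m : Multiset α} (h : a ∉ m) :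
    multiplicities (a ::ₘ m) = 1 ::ₘ multiplicities m := by
  simpa using multiplicities_replicate_add 0 h

theorem multiplicities_zero {α : Type*} [DecidableEq α] :
    multiplicities (0 : Multiset α) = 0 := by
  simp [multiplicities]

theorem multiplicities_replicate {α : Type*} [DecidableEq α] (a : α) (k : ℕ) :
    multiplicities (Multiset.replicate (k + 1) a) = {k + 1} := by
  simpa [multiplicities_zero] using multiplicities_replicate_add k (Multiset.notMem_zero a)

theorem multiplicities_replicate_pair {α : Type*} [DecidableEq α] {a b : α} (k l : ℕ)
    (h : a ≠ b) :
    multiplicities (Multiset.replicate (k + 1) a + Multiset.replicate (l + 1) b) =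
      {k + 1, l + 1} := by
  rw [multiplicities_replicate_add, multiplicities_replicate]
  · rfl
  · simp [Multiset.mem_replicate, h]

theorem multiplicities_conjRoots [DecidableEq ℂ] {w : ℝ × ℝ} (hw : 0 < w.2) :
    multiplicities (conjRoots w) = {1, 1} :=
  multiplicities_replicate_pair 0 0 fun h => by
    have := congrArg Complex.im h
    simp only at this
    linarith

theorem multiplicities_conjRoots_add_self [DecidableEq ℂ] {w : ℝ × ℝ} (hw : 0 < w.2) :
    multiplicities (conjRoots w + conjRoots w) = {2, 2} := by
  rw [← multiplicities_replicate_pair (a := (⟨w.1, w.2⟩ : ℂ)) (b := ⟨w.1, -w.2⟩) 1 1 fun h => by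
    have := congrArg Complex.im h
    simp only at this
    linarith]
  congr 1
  exact add_add_add_comm ({⟨w.1, w.2⟩} : Multiset ℂ) {⟨w.1, -w.2⟩} {⟨w.1, w.2⟩} {⟨w.1, -w.2⟩}

theorem multiplicities_conjRoots_add [DecidableEq ℂ] {w z : ℝ × ℝ} (hw : 0 < w.2) (hz : 0 < z.2)
    (hwz : w ≠ z) : multiplicities (conjRoots w + conjRoots z) = {1, 1, 1, 1} := by
  -- The signs run over all four comparisons: equal signs are excluded by `hwz`, opposite signs by
  -- positivity of the imaginary parts.
  have h (ε δ : ℝ) (hε : ε = 1 ∨ ε = -1) (hδ : δ = 1 ∨ δ = -1) :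
      (⟨w.1, ε * w.2⟩ : ℂ) ≠ ⟨z.1, δ * z.2⟩ := by
    intro h
    have h1 := congrArg Complex.re h
    have h2 := congrArg Complex.im h
    simp only at h1 h2
    refine hwz (Prod.ext h1 ?_)
    rcases hε with rfl | rfl <;> rcases hδ with rfl | rfl <;> linarith
  have h1 := h 1 1 (by simp) (by simp)
  have h2 := h 1 (-1) (by simp) (by simp)
  have h3 := h (-1) 1 (by simp) (by simp)
  have h4 := h (-1) (-1) (by simp) (by simp)
  simp only [one_mul, neg_mul] at h1 h2 h3 h4
  have h5 : (⟨w.1, w.2⟩ : ℂ) ≠ ⟨w.1, -w.2⟩ := fun h => by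
    have := congrArg Complex.im h
    simp only at this
    linarith
  change multiplicities (_ ::ₘ _ ::ₘ conjRoots z) = _
  rw [multiplicities_cons, multiplicities_cons, multiplicities_conjRoots hz]
  · rfl
  · simp [conjRoots, h3, h4]
  · simp [conjRoots, h1, h2, h5]

/-! ### The twelve classes -/

/-- The condition on the coefficients that characterizes a class. -/
def RootClass.Condition (c : RootClass) (p q r s t : ℝ) : Prop :=
  match c with
  | fiveReal => 0 < L3 p q ∧ 0 < L2 p q r s ∧ 0 < L1 p q r s t ∧ 0 < D p q r s t
  | threeReal => D p q r s t < 0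
  | oneReal => 0 < D p q r s t ∧ (L3 p q ≤ 0 ∨ L2 p q r s ≤ 0 ∨ L1 p q r s t ≤ 0)
  | doubleThreeSingle => D p q r s t = 0 ∧ 0 < L1 p q r s t
  | doubleSingleConj => D p q r s t = 0 ∧ L1 p q r s t < 0
  | twoDoubleSingle =>
    D p q r s t = 0 ∧ L1 p q r s t = 0 ∧ L2 p q r s ≠ 0 ∧ 0 < D2 p q r s t
  | conjDoubleSingle =>
    D p q r s t = 0 ∧ L1 p q r s t = 0 ∧ L2 p q r s ≠ 0 ∧ D2 p q r s t < 0
  | tripleTwoSingle =>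
    D p q r s t = 0 ∧ L1 p q r s t = 0 ∧ 0 < L2 p q r s ∧ D2 p q r s t = 0
  | tripleConj => D p q r s t = 0 ∧ L1 p q r s t = 0 ∧ L2 p q r s < 0 ∧ D2 p q r s t = 0
  | quadrupleSingle =>
    D p q r s t = 0 ∧ L1 p q r s t = 0 ∧ L2 p q r s = 0 ∧ L3 p q ≠ 0 ∧ M1 p q r s = 0
  | tripleDouble =>
    D p q r s t = 0 ∧ L1 p q r s t = 0 ∧ L2 p q r s = 0 ∧ L3 p q ≠ 0 ∧ M1 p q r s ≠ 0
  | quintuple => D p q r s t = 0 ∧ L1 p q r s t = 0 ∧ L2 p q r s = 0 ∧ L3 p q = 0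

/-- The conditions are leaves of one decision tree on the signs of `D`, `L1`, `L2`, `D2`, `L3` and
the vanishing of `M1`. -/
theorem RootClass.eq_of_condition {c c' : RootClass} {p q r s t : ℝ}
    (h : c.Condition p q r s t) (h' : c'.Condition p q r s t) : c = c' := by
  cases c <;> cases c' <;> first | rfl | (simp only [Condition] at h h'; grind)

/-- The real multiplicities already separate all classes except `oneReal` and `conjDoubleSingle`. -/
theorem RootClass.eq_of_contains {c c' : RootClass} {f : ℝ[X]}
    (h : c.Contains f) (h' : c'.Contains f) : c = c' := by
  have h1 : c.real = c'.real := h.1.symm.trans h'.1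
  have h2 : c.nonreal = c'.nonreal := h.2.symm.trans h'.2
  cases c <;> cases c' <;>
    first | rfl | exact absurd h1 (by decide) | exact absurd h2 (by decide)

variable {p q r s t a b c d e u v : ℝ}

/-- The quintic belongs to a class whose condition is satisfied. -/
def IsClassified (p q r s t : ℝ) : Prop :=
  ∃ c : RootClass, c.Contains (quintic p q r s t) ∧ c.Condition p q r s t

/-! ### Verification of the condition for each root pattern. -/

theorem isClassified_five (hab : a ≠ b) (hac : a ≠ c) (had : a ≠ d) (hae : a ≠ e) (hbc : b ≠ c)
    (hbd : b ≠ d) (hbe : b ≠ e) (hcd : c ≠ d) (hce : c ≠ e) (hde : d ≠ e)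
    (h : quintic p q r s t = (X - C a) * (X - C b) * (X - C c) * (X - C d) * (X - C e)) :
    IsClassified p q r s t := by
  classical
  refine ⟨.fiveReal, ?_, ?_⟩
  · obtain ⟨h1, h2⟩ := multiplicities_of_factorization {a, b, c, d, e} 0 (by simp)
      (h.trans (by simp [-mul_eq_mul_left_iff, -mul_eq_mul_right_iff]; ring))
    refine ⟨h1.trans ?_, h2.trans ?_⟩
    · change multiplicities (a ::ₘ b ::ₘ c ::ₘ d ::ₘ e ::ₘ 0) = _
      rw [multiplicities_cons, multiplicities_cons, multiplicities_cons, multiplicities_cons,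
        multiplicities_cons, multiplicities_zero]
      · rfl
      all_goals simp [*]
    · simp [multiplicities_zero, RootClass.nonreal]
  · obtain ⟨hD, h1, h2, h3, -, -⟩ := invariants_of_factorization (a := a)
      (b := -((b - a) + (c - a))) (c := (b - a)*(c - a))
      (d := -((d - a) + (e - a))) (e := (d - a)*(e - a)) (h.trans (by simp; ring))
    rw [D_of_quadratic_factors] at hD
    rw [L1_of_five_roots] at h1
    rw [L2_of_five_roots] at h2
    have h3' := two_mul_L3_of_five_roots (b - a) (c - a) (d - a) (e - a)
    rw [← h3] at h3'
    have hab' := sub_ne_zero.2 hab.symm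
    have hac' := sub_ne_zero.2 hac.symm
    have had' := sub_ne_zero.2 had.symm
    have hae' := sub_ne_zero.2 hae.symm
    have hbc' : b - a - (c - a) ≠ 0 := by simpa [sub_eq_zero] using hbc
    have hbd' : b - a - (d - a) ≠ 0 := by simpa [sub_eq_zero] using hbd
    have hbe' : b - a - (e - a) ≠ 0 := by simpa [sub_eq_zero] using hbe
    have hcd' : c - a - (d - a) ≠ 0 := by simpa [sub_eq_zero] using hcd
    have hce' : c - a - (e - a) ≠ 0 := by simpa [sub_eq_zero] using hce
    have hde' : d - a - (e - a) ≠ 0 := by simpa [sub_eq_zero] using hde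
    generalize b - a = x at *
    generalize c - a = y at *
    generalize d - a = z at *
    generalize e - a = w at *
    refine ⟨?_, ?_, ?_, ?_⟩
    · have : 0 < x^2 + y^2 + z^2 + w^2 + (x - y)^2 + (x - z)^2 + (x - w)^2 + (y - z)^2 +
        (y - w)^2 + (z - w)^2 := by positivity
      linarith
    · rw [h2]
      positivity
    · rw [h1]
      positivity
    · have : D p q r s t =
          (x*y*z*w*(x - y)*(x - z)*(x - w)*(y - z)*(y - w)*(z - w))^2 := by
        rw [hD]
        ring
      rw [this]
      positivity

theorem isClassified_three (hab : a ≠ b) (hac : a ≠ c) (hbc : b ≠ c) (hv : 0 < v)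
    (h : quintic p q r s t = (X - C a) * (X - C b) * (X - C c) * conjQuadratic (u, v)) :
    IsClassified p q r s t := by
  classical
  refine ⟨.threeReal, ?_, ?_⟩
  · obtain ⟨h1, h2⟩ := multiplicities_of_factorization {a, b, c} {(u, v)} (by simpa)
      (h.trans (by simp [-mul_eq_mul_left_iff, -mul_eq_mul_right_iff]; ring))
    refine ⟨h1.trans ?_, h2.trans ?_⟩
    · change multiplicities (a ::ₘ b ::ₘ c ::ₘ 0) = _
      rw [multiplicities_cons, multiplicities_cons, multiplicities_cons, multiplicities_zero]
      · rfl
      all_goals simp [*]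
    · rw [Multiset.singleton_bind, multiplicities_conjRoots hv]
      rfl
  · obtain ⟨hD, -⟩ := invariants_of_factorization (a := a)
      (b := -((b - a) + (c - a))) (c := (b - a)*(c - a))
      (d := -2*(u - a)) (e := (u - a)^2 + v^2) (h.trans (by simp [conjQuadratic, map_ofNat]; ring))
    have hd1 : (-((b - a) + (c - a)))^2 - 4*((b - a)*(c - a)) = (b - c)^2 := by ring
    have hd2 : (-2*(u - a))^2 - 4*((u - a)^2 + v^2) = -(4*v^2) := by ring
    -- The resultant is the product of the values of the conjugate quadratic at `b` and `c`, hence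
    -- positive; the sign of `D` comes from the discriminant `-(4*v^2)`.
    have hres : ((b - a)*(c - a) - ((u - a)^2 + v^2))^2 +
        (-((b - a) + (c - a)) - -2*(u - a))*
          (-((b - a) + (c - a))*((u - a)^2 + v^2) - (b - a)*(c - a)*(-2*(u - a))) =
        ((b - u)^2 + v^2)*((c - u)^2 + v^2) := by ring
    rw [D_of_quadratic_factors, hd1, hd2, hres, mul_neg, neg_mul] at hD
    have hab' := sub_ne_zero.2 hab.symm
    have hac' := sub_ne_zero.2 hac.symm
    have hbc' := sub_ne_zero.2 hbc
    change D p q r s t < 0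
    rw [hD, neg_lt_zero]
    positivity

theorem isClassified_one {w z : ℝ} (hv : 0 < v) (hz : 0 < z) (hne : (u, v) ≠ (w, z))
    (h : quintic p q r s t = (X - C a) * conjQuadratic (u, v) * conjQuadratic (w, z)) :
    IsClassified p q r s t := by
  classical
  refine ⟨.oneReal, ?_, ?_⟩
  · obtain ⟨h1, h2⟩ := multiplicities_of_factorization {a} {(u, v), (w, z)} (by simp [hv, hz])
      (h.trans (by simp [-mul_eq_mul_left_iff, -mul_eq_mul_right_iff]; ring))
    refine ⟨h1.trans (multiplicities_replicate a 0), h2.trans ?_⟩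
    rw [Multiset.insert_eq_cons, Multiset.cons_bind, Multiset.singleton_bind,
      multiplicities_conjRoots_add hv hz hne]
    rfl
  · obtain ⟨hD, h1, h2, h3, -⟩ := invariants_of_factorization (a := a)
      (b := -2*(u - a)) (c := (u - a)^2 + v^2)
      (d := -2*(w - a)) (e := (w - a)^2 + z^2) (h.trans (by simp [conjQuadratic, map_ofNat]; ring))
    have hd (x y : ℝ) : (-2*(x - a))^2 - 4*((x - a)^2 + y^2) = -(4*y^2) := by ring
    -- With `ζ = u + iv` and `ω = w + iz`, the resultant is `|ζ - ω|^2` times the squared distance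
    -- from `ζ` to the conjugate of `ω`.
    have hres : ((u - a)^2 + v^2 - ((w - a)^2 + z^2))^2 +
        (-2*(u - a) - -2*(w - a))*
          (-2*(u - a)*((w - a)^2 + z^2) - ((u - a)^2 + v^2)*(-2*(w - a))) =
        ((u - w)^2 + (v - z)^2)*((u - w)^2 + (v + z)^2) := by ring
    rw [D_of_quadratic_factors, hd, hd, hres] at hD
    simp only [mul_neg, neg_mul, neg_neg] at hD
    have hpos : 0 < (u - w)^2 + (v - z)^2 := by
      by_cases huw : u = w
      · have : v - z ≠ 0 := sub_ne_zero.2 fun hvz => hne (by rw [huw, hvz])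
        positivity
      · have := sub_ne_zero.2 huw
        positivity
    refine ⟨?_, ?_⟩
    · rw [hD]
      positivity
    · rw [h1, h2, h3]
      exact not_all_pos_of_two_conj_pairs _ _ _ _

theorem isClassified_two_one_one_one (hab : a ≠ b) (hac : a ≠ c) (had : a ≠ d) (hbc : b ≠ c)
    (hbd : b ≠ d) (hcd : c ≠ d)
    (h : quintic p q r s t = (X - C a)^2 * (X - C b) * (X - C c) * (X - C d)) :
    IsClassified p q r s t := by
  classical
  refine ⟨.doubleThreeSingle, ?_, ?_⟩
  · obtain ⟨h1, h2⟩ := multiplicities_of_factorization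
      (Multiset.replicate 2 a + {b, c, d}) 0 (by simp) (h.trans (by simp [-mul_eq_mul_left_iff, -mul_eq_mul_right_iff]; ring))
    refine ⟨h1.trans ?_, h2.trans ?_⟩
    · change multiplicities (_ + (b ::ₘ c ::ₘ d ::ₘ 0)) = _
      rw [multiplicities_replicate_add, multiplicities_cons, multiplicities_cons,
        multiplicities_cons, multiplicities_zero]
      · rfl
      all_goals simp [*]
    · simp [multiplicities_zero, RootClass.nonreal]
  -- `c := 0` puts the second copy of `a` into the first quadratic, and makes the factor `c * e` of
  -- `D` vanish.
  · obtain ⟨hD, h1, -⟩ := invariants_of_factorization (a := a)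
      (b := -(b - a)) (c := 0)
      (d := -((c - a) + (d - a))) (e := (c - a)*(d - a)) (h.trans (by simp; ring))
    have : L1 p q r s t = 2*((b - a)*((c - a)*(d - a))*((b - c)*(b - d)))^2*(c - d)^2 := by
      rw [h1, L1_of_double_root]
      ring
    have hab' := sub_ne_zero.2 hab.symm
    have hac' := sub_ne_zero.2 hac.symm
    have had' := sub_ne_zero.2 had.symm
    have hbc' := sub_ne_zero.2 hbc
    have hbd' := sub_ne_zero.2 hbd
    have hcd' := sub_ne_zero.2 hcd
    refine ⟨?_, ?_⟩
    · rw [hD, D_of_quadratic_factors]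
      ring
    · rw [this]
      positivity

theorem isClassified_two_one (hab : a ≠ b) (hv : 0 < v)
    (h : quintic p q r s t = (X - C a)^2 * (X - C b) * conjQuadratic (u, v)) :
    IsClassified p q r s t := by
  classical
  refine ⟨.doubleSingleConj, ?_, ?_⟩
  · obtain ⟨h1, h2⟩ := multiplicities_of_factorization
      (Multiset.replicate 2 a + Multiset.replicate 1 b) {(u, v)} (by simpa) (h.trans (by simp [-mul_eq_mul_left_iff, -mul_eq_mul_right_iff]; ring))
    refine ⟨h1.trans (multiplicities_replicate_pair 1 0 hab), h2.trans ?_⟩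
    rw [Multiset.singleton_bind, multiplicities_conjRoots hv]
    rfl
  · obtain ⟨hD, h1, -⟩ := invariants_of_factorization (a := a)
      (b := -(b - a)) (c := 0)
      (d := -2*(u - a)) (e := (u - a)^2 + v^2) (h.trans (by simp [conjQuadratic, map_ofNat]; ring))
    have : L1 p q r s t =
        -(8*((b - a)*((u - a)^2 + v^2)*((b - u)^2 + v^2))^2*v^2) := by
      rw [h1, L1_of_double_root]
      ring
    have hab' := sub_ne_zero.2 hab.symm
    refine ⟨?_, ?_⟩
    · rw [hD, D_of_quadratic_factors]
      ring
    · rw [this, neg_lt_zero]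
      positivity

theorem isClassified_two_two_one (hab : a ≠ b) (hac : a ≠ c) (hbc : b ≠ c)
    (h : quintic p q r s t = (X - C a)^2 * (X - C b)^2 * (X - C c)) :
    IsClassified p q r s t := by
  classical
  refine ⟨.twoDoubleSingle, ?_, ?_⟩
  · obtain ⟨h1, h2⟩ := multiplicities_of_factorization
      (Multiset.replicate 2 a + (Multiset.replicate 2 b + {c})) 0 (by simp)
      (h.trans (by simp [-mul_eq_mul_left_iff, -mul_eq_mul_right_iff]; ring))
    refine ⟨h1.trans ?_, h2.trans ?_⟩
    · change multiplicities (_ + (_ + (c ::ₘ 0))) = _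
      rw [multiplicities_replicate_add, multiplicities_replicate_add, multiplicities_cons,
        multiplicities_zero]
      · rfl
      all_goals simp [*]
    · simp [multiplicities_zero, RootClass.nonreal]
  -- The simple root goes to the origin, so the two quadratics coincide and their resultant, hence
  -- `D`, is 0.
  · obtain ⟨hD, h1, h2, -, h4, -⟩ := invariants_of_factorization (a := c)
      (b := -((a - c) + (b - c))) (c := (a - c)*(b - c))
      (d := -((a - c) + (b - c))) (e := (a - c)*(b - c)) (h.trans (by simp; ring))
    rw [L1_of_two_double_roots] at h1
    have h2' : L2 p q r s = 4*((a - c)*(b - c))^2*(a - b)^2 := by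
      rw [h2, L2_of_two_double_roots]
      ring
    have h4' : D2 p q r s t = 4*((a - c)*(b - c))^4*((a - b)^2)^3 := by
      rw [h4, D2_of_two_double_roots]
      ring
    have hab' := sub_ne_zero.2 hab
    have hac' := sub_ne_zero.2 hac
    have hbc' := sub_ne_zero.2 hbc
    refine ⟨?_, h1, ?_, ?_⟩
    · rw [hD, D_of_quadratic_factors]
      ring
    · rw [h2']
      positivity
    · rw [h4']
      positivity

theorem isClassified_one_of_double_pair (hv : 0 < v)
    (h : quintic p q r s t = (X - C a) * conjQuadratic (u, v)^2) :
    IsClassified p q r s t := by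
  classical
  refine ⟨.conjDoubleSingle, ?_, ?_⟩
  · obtain ⟨h1, h2⟩ := multiplicities_of_factorization {a} {(u, v), (u, v)} (by simpa)
      (h.trans (by simp [-mul_eq_mul_left_iff, -mul_eq_mul_right_iff]; ring))
    refine ⟨h1.trans (multiplicities_replicate a 0), h2.trans ?_⟩
    rw [Multiset.insert_eq_cons, Multiset.cons_bind, Multiset.singleton_bind,
      multiplicities_conjRoots_add_self hv]
    rfl
  · obtain ⟨hD, h1, h2, -, h4, -⟩ := invariants_of_factorization (a := a)
      (b := -2*(u - a)) (c := (u - a)^2 + v^2)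
      (d := -2*(u - a)) (e := (u - a)^2 + v^2) (h.trans (by simp [conjQuadratic, map_ofNat]; ring))
    rw [L1_of_two_double_roots] at h1
    have h2' : L2 p q r s = -(16*((u - a)^2 + v^2)^2*v^2) := by
      rw [h2, L2_of_two_double_roots]
      ring
    have h4' : D2 p q r s t = -(256*((u - a)^2 + v^2)^4*v^6) := by
      rw [h4, D2_of_two_double_roots]
      ring
    refine ⟨?_, h1, ?_, ?_⟩
    · rw [hD, D_of_quadratic_factors]
      ring
    · rw [h2', neg_ne_zero]
      positivity
    · rw [h4', neg_lt_zero]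
      positivity

theorem isClassified_three_one_one (hab : a ≠ b) (hac : a ≠ c) (hbc : b ≠ c)
    (h : quintic p q r s t = (X - C a)^3 * (X - C b) * (X - C c)) :
    IsClassified p q r s t := by
  classical
  refine ⟨.tripleTwoSingle, ?_, ?_⟩
  · obtain ⟨h1, h2⟩ := multiplicities_of_factorization
      (Multiset.replicate 3 a + {b, c}) 0 (by simp) (h.trans (by simp [-mul_eq_mul_left_iff, -mul_eq_mul_right_iff]; ring))
    refine ⟨h1.trans ?_, h2.trans ?_⟩
    · change multiplicities (_ + (b ::ₘ c ::ₘ 0)) = _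
      rw [multiplicities_replicate_add, multiplicities_cons, multiplicities_cons,
        multiplicities_zero]
      · rfl
      all_goals simp [*]
    · simp [multiplicities_zero, RootClass.nonreal]
  · obtain ⟨hD, h1, h2, -, h4, -⟩ := invariants_of_factorization (a := a)
      (b := 0) (c := 0)
      (d := -((b - a) + (c - a))) (e := (b - a)*(c - a)) (h.trans (by simp; ring))
    have h2' : L2 p q r s = 3*((b - a)*(c - a))^2*(b - c)^2 := by
      rw [h2, L2_of_triple_root]
      ring
    have hab' := sub_ne_zero.2 hab.symm
    have hac' := sub_ne_zero.2 hac.symm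
    have hbc' := sub_ne_zero.2 hbc
    refine ⟨?_, ?_, ?_, ?_⟩
    · rw [hD, D_of_quadratic_factors]
      ring
    · rw [h1, L1_of_double_root]
      ring
    · rw [h2']
      positivity
    · rw [h4, D2_of_triple_root]

theorem isClassified_three_of_pair (hv : 0 < v)
    (h : quintic p q r s t = (X - C a)^3 * conjQuadratic (u, v)) :
    IsClassified p q r s t := by
  classical
  refine ⟨.tripleConj, ?_, ?_⟩
  · obtain ⟨h1, h2⟩ := multiplicities_of_factorization
      (Multiset.replicate 3 a) {(u, v)} (by simpa) (h.trans (by simp [-mul_eq_mul_left_iff, -mul_eq_mul_right_iff]; ring))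
    refine ⟨h1.trans (multiplicities_replicate a 2), h2.trans ?_⟩
    rw [Multiset.singleton_bind, multiplicities_conjRoots hv]
    rfl
  · obtain ⟨hD, h1, h2, -, h4, -⟩ := invariants_of_factorization (a := a)
      (b := 0) (c := 0)
      (d := -2*(u - a)) (e := (u - a)^2 + v^2) (h.trans (by simp [conjQuadratic, map_ofNat]; ring))
    have h2' : L2 p q r s = -(12*((u - a)^2 + v^2)^2*v^2) := by
      rw [h2, L2_of_triple_root]
      ring
    refine ⟨?_, ?_, ?_, ?_⟩
    · rw [hD, D_of_quadratic_factors]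
      ring
    · rw [h1, L1_of_double_root]
      ring
    · rw [h2', neg_lt_zero]
      positivity
    · rw [h4, D2_of_triple_root]

theorem isClassified_four_one (hab : a ≠ b)
    (h : quintic p q r s t = (X - C a)^4 * (X - C b)) : IsClassified p q r s t := by
  classical
  refine ⟨.quadrupleSingle, ?_, ?_⟩
  · obtain ⟨h1, h2⟩ := multiplicities_of_factorization
      (Multiset.replicate 4 a + Multiset.replicate 1 b) 0 (by simp) (h.trans (by simp [-mul_eq_mul_left_iff, -mul_eq_mul_right_iff]; ring))
    refine ⟨h1.trans (multiplicities_replicate_pair 3 0 hab), h2.trans ?_⟩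
    simp [multiplicities_zero, RootClass.nonreal]
  · obtain ⟨hD, h1, h2, h3, -, h5⟩ := invariants_of_factorization (a := a)
      (b := 0) (c := 0) (d := -(b - a)) (e := 0) (h.trans (by simp; ring))
    have h3' : L3 p q = 2*(b - a)^2 := by
      rw [h3, L3]
      ring
    have hab' := sub_ne_zero.2 hab.symm
    refine ⟨?_, ?_, ?_, ?_, ?_⟩
    · rw [hD, D_of_quadratic_factors]
      ring
    · rw [h1, L1_of_double_root]
      ring
    · rw [h2, L2_of_triple_root]
      ring
    · rw [h3']
      positivity
    · rw [h5, M1]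
      ring

theorem isClassified_three_two (hab : a ≠ b)
    (h : quintic p q r s t = (X - C a)^3 * (X - C b)^2) : IsClassified p q r s t := by
  classical
  refine ⟨.tripleDouble, ?_, ?_⟩
  · obtain ⟨h1, h2⟩ := multiplicities_of_factorization
      (Multiset.replicate 3 a + Multiset.replicate 2 b) 0 (by simp) (h.trans (by simp [-mul_eq_mul_left_iff, -mul_eq_mul_right_iff]; ring))
    refine ⟨h1.trans (multiplicities_replicate_pair 2 1 hab), h2.trans ?_⟩
    simp [multiplicities_zero, RootClass.nonreal]
  · obtain ⟨hD, h1, h2, h3, -, h5⟩ := invariants_of_factorization (a := a)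
      (b := 0) (c := 0) (d := -2*(b - a)) (e := (b - a)^2) (h.trans (by simp [map_ofNat]; ring))
    have h3' : L3 p q = 3*(b - a)^2 := by
      rw [h3, L3]
      ring
    -- `M1` is what tells this pattern from a quadruple root, where it vanishes.
    have h5' : M1 p q r s = -12*(b - a)^6 := by
      rw [h5, M1]
      ring
    have hab' := sub_ne_zero.2 hab.symm
    refine ⟨?_, ?_, ?_, ?_, ?_⟩
    · rw [hD, D_of_quadratic_factors]
      ring
    · rw [h1, L1_of_double_root]
      ring
    · rw [h2, L2_of_triple_root]
      ring
    · rw [h3']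
      positivity
    · rw [h5']
      simpa using hab'

theorem isClassified_of_quintuple (h : quintic p q r s t = (X - C a)^5) :
    IsClassified p q r s t := by
  classical
  refine ⟨.quintuple, ?_, ?_⟩
  · obtain ⟨h1, h2⟩ := multiplicities_of_factorization
      (Multiset.replicate 5 a) 0 (by simp) (h.trans (by simp [-mul_eq_mul_left_iff, -mul_eq_mul_right_iff]; ring))
    refine ⟨h1.trans (multiplicities_replicate a 4), h2.trans ?_⟩
    simp [multiplicities_zero, RootClass.nonreal]
  · obtain ⟨hD, h1, h2, h3, -⟩ := invariants_of_factorization (a := a)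
      (b := 0) (c := 0) (d := 0) (e := 0) (h.trans (by simp; ring))
    refine ⟨?_, ?_, ?_, ?_⟩
    · rw [hD, D_of_quadratic_factors]
      ring
    · rw [h1, L1_of_double_root]
      ring
    · rw [h2, L2_of_triple_root]
      ring
    · rw [h3, L3]
      ring

/-! ### Reduction of an arbitrary quintic to the root patterns. -/

theorem isClassified_of_real_roots (hab : a ≤ b) (hbc : b ≤ c) (hcd : c ≤ d) (hde : d ≤ e)
    (h : quintic p q r s t = (X - C a) * (X - C b) * (X - C c) * (X - C d) * (X - C e)) :
    IsClassified p q r s t := by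
  -- The 16 patterns of equality between neighbours are the compositions of 5; each is reordered so
  -- that the largest multiplicities come first.
  rcases hab.eq_or_lt with rfl | hab <;> rcases hbc.eq_or_lt with rfl | hbc <;>
    rcases hcd.eq_or_lt with rfl | hcd <;> rcases hde.eq_or_lt with rfl | hde
  · exact isClassified_of_quintuple (h.trans (by ring))
  · exact isClassified_four_one hde.ne (h.trans (by ring))
  · exact isClassified_three_two hcd.ne (h.trans (by ring))
  · exact isClassified_three_one_one (b := d) (c := e) hcd.ne (by order) hde.ne (h.trans (by ring))
  · exact isClassified_three_two hbc.ne' (h.trans (by ring))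
  · exact isClassified_two_two_one (c := e) hbc.ne (by order) hde.ne (h.trans (by ring))
  · exact isClassified_two_two_one (b := d) (c := c) (by order) hbc.ne hcd.ne'
      (h.trans (by ring))
  · exact isClassified_two_one_one_one (b := c) (c := d) (d := e) hbc.ne (by order) (by order)
      hcd.ne (by order) hde.ne (h.trans (by ring))
  · exact isClassified_four_one hab.ne' (h.trans (by ring))
  · exact isClassified_three_one_one (b := a) (c := e) hab.ne' hde.ne (by order)
      (h.trans (by ring))
  · exact isClassified_two_two_one (b := d) (c := a) hcd.ne hab.ne' (by order)
      (h.trans (by ring))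
  · exact isClassified_two_one_one_one (b := a) (c := d) (d := e) hab.ne' hcd.ne (by order)
      (by order) (by order) hde.ne (h.trans (by ring))
  · exact isClassified_three_one_one (b := a) (c := b) (by order) hbc.ne' hab.ne
      (h.trans (by ring))
  · exact isClassified_two_one_one_one (b := a) (c := b) (d := e) (by order) hbc.ne' hde.ne
      hab.ne (by order) (by order) (h.trans (by ring))
  · exact isClassified_two_one_one_one (b := a) (c := b) (d := c) (by order) (by order) hcd.ne'
      hab.ne (by order) hbc.ne (h.trans (by ring))
  · exact isClassified_five hab.ne (by order) (by order) (by order) hbc.ne (by order) (by order)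
      hcd.ne (by order) hde.ne h

theorem isClassified_of_conj_pair (hab : a ≤ b) (hbc : b ≤ c) (hv : 0 < v)
    (h : quintic p q r s t = (X - C a) * (X - C b) * (X - C c) * conjQuadratic (u, v)) :
    IsClassified p q r s t := by
  rcases hab.eq_or_lt with rfl | hab <;> rcases hbc.eq_or_lt with rfl | hbc
  · exact isClassified_three_of_pair hv (h.trans (by ring))
  · exact isClassified_two_one hbc.ne hv (h.trans (by ring))
  · exact isClassified_two_one hab.ne' hv (h.trans (by ring))
  · exact isClassified_three hab.ne (hab.trans hbc).ne hbc.ne hv h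

theorem natDegree_quintic (p q r s t : ℝ) : (quintic p q r s t).natDegree = 5 := by
  unfold quintic
  compute_degree!

theorem monic_quintic (p q r s t : ℝ) : (quintic p q r s t).Monic := by
  unfold quintic
  monicity!

theorem isClassified (p q r s t : ℝ) : IsClassified p q r s t := by
  obtain ⟨R, Q, hQ, hf⟩ := exists_factorization _ _ (monic_quintic p q r s t) rfl
  have hcard := natDegree_factorization R Q
  rw [← hf, natDegree_quintic] at hcard
  obtain ⟨l, hl, rfl⟩ : ∃ l : List ℝ, l.Pairwise (· ≤ ·) ∧ (l : Multiset ℝ) = R :=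
    ⟨R.sort (· ≤ ·), R.pairwise_sort _, R.sort_eq _⟩
  rw [Multiset.coe_card] at hcard
  -- The degree count reads `5 = l.length + 2 * Q.card`, which also fixes the number of real roots.
  obtain hQc | hQc | hQc : Q.card = 0 ∨ Q.card = 1 ∨ Q.card = 2 := by omega
  · obtain rfl := Multiset.card_eq_zero.1 hQc
    obtain ⟨a, b, c, d, e, rfl⟩ : ∃ a b c d e, l = [a, b, c, d, e] := by
      match l, hcard with
      | [a, b, c, d, e], _ => exact ⟨a, b, c, d, e, rfl⟩
    simp only [List.pairwise_cons, List.mem_cons] at hl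
    refine isClassified_of_real_roots (hl.1 b (by simp)) (hl.2.1 c (by simp))
      (hl.2.2.1 d (by simp)) (hl.2.2.2.1 e (by simp)) (hf.trans ?_)
    simp [mul_assoc]
  · obtain ⟨⟨u, v⟩, rfl⟩ := Multiset.card_eq_one.1 hQc
    obtain ⟨a, b, c, rfl⟩ : ∃ a b c, l = [a, b, c] := by
      match l, hcard with
      | [a, b, c], _ => exact ⟨a, b, c, rfl⟩
    simp only [List.pairwise_cons, List.mem_cons] at hl
    refine isClassified_of_conj_pair (u := u) (hl.1 b (by simp)) (hl.2.1 c (by simp))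
      (hQ (u, v) (by simp)) (hf.trans ?_)
    simp [mul_assoc]
  · obtain ⟨⟨u, v⟩, ⟨w, z⟩, rfl⟩ := Multiset.card_eq_two.1 hQc
    obtain ⟨a, rfl⟩ : ∃ a, l = [a] := by
      match l, hcard with
      | [a], _ => exact ⟨a, rfl⟩
    have hv : 0 < v := hQ (u, v) (by simp)
    have hz : 0 < z := hQ (w, z) (by simp)
    have hf' : quintic p q r s t =
        (X - C a) * conjQuadratic (u, v) * conjQuadratic (w, z) :=
      hf.trans (by simp [mul_assoc])
    by_cases hne : (u, v) = (w, z)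
    · exact isClassified_one_of_double_pair hv (hf'.trans (by rw [← hne]; ring))
    · exact isClassified_one hv hz hne hf'

/-- The class `c'` supplied by `isClassified` has both properties; either one forces `c = c'` by
exclusivity, and the other then transfers. -/
theorem RootClass.contains_iff_condition (c : RootClass) (p q r s t : ℝ) :
    c.Contains (quintic p q r s t) ↔ c.Condition p q r s t := by
  obtain ⟨c', h, h'⟩ := isClassified p q r s t
  constructor
  · intro hc
    rwa [eq_of_contains hc h]
  · intro hc
    rwa [eq_of_condition hc h']

end RealQuintic

theorem mainTheorem1 (p q r s t : ℝ) :
    (∃! c : RealQuintic.RootClass, c.Contains (RealQuintic.quintic p q r s t)) ∧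
    (RealQuintic.RootClass.fiveReal.Contains (RealQuintic.quintic p q r s t) ↔
        0 < RealQuintic.L3 p q ∧ 0 < RealQuintic.L2 p q r s ∧ 0 < RealQuintic.L1 p q r s t ∧
        0 < RealQuintic.D p q r s t) ∧
    (RealQuintic.RootClass.threeReal.Contains (RealQuintic.quintic p q r s t) ↔
        RealQuintic.D p q r s t < 0) ∧
    (RealQuintic.RootClass.oneReal.Contains (RealQuintic.quintic p q r s t) ↔
        0 < RealQuintic.D p q r s t ∧
          (RealQuintic.L3 p q ≤ 0 ∨ RealQuintic.L2 p q r s ≤ 0 ∨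
            RealQuintic.L1 p q r s t ≤ 0)) ∧
    (RealQuintic.RootClass.doubleThreeSingle.Contains (RealQuintic.quintic p q r s t) ↔
        RealQuintic.D p q r s t = 0 ∧ 0 < RealQuintic.L1 p q r s t) ∧
    (RealQuintic.RootClass.doubleSingleConj.Contains (RealQuintic.quintic p q r s t) ↔
        RealQuintic.D p q r s t = 0 ∧ RealQuintic.L1 p q r s t < 0) ∧
    (RealQuintic.RootClass.twoDoubleSingle.Contains (RealQuintic.quintic p q r s t) ↔
        RealQuintic.D p q r s t = 0 ∧ RealQuintic.L1 p q r s t = 0 ∧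
        RealQuintic.L2 p q r s ≠ 0 ∧ 0 < RealQuintic.D2 p q r s t) ∧
    (RealQuintic.RootClass.conjDoubleSingle.Contains (RealQuintic.quintic p q r s t) ↔
        RealQuintic.D p q r s t = 0 ∧ RealQuintic.L1 p q r s t = 0 ∧
        RealQuintic.L2 p q r s ≠ 0 ∧ RealQuintic.D2 p q r s t < 0) ∧
    (RealQuintic.RootClass.tripleTwoSingle.Contains (RealQuintic.quintic p q r s t) ↔
        RealQuintic.D p q r s t = 0 ∧ RealQuintic.L1 p q r s t = 0 ∧
        0 < RealQuintic.L2 p q r s ∧ RealQuintic.D2 p q r s t = 0) ∧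
    (RealQuintic.RootClass.tripleConj.Contains (RealQuintic.quintic p q r s t) ↔
        RealQuintic.D p q r s t = 0 ∧ RealQuintic.L1 p q r s t = 0 ∧
        RealQuintic.L2 p q r s < 0 ∧ RealQuintic.D2 p q r s t = 0) ∧
    (RealQuintic.RootClass.quadrupleSingle.Contains (RealQuintic.quintic p q r s t) ↔
        RealQuintic.D p q r s t = 0 ∧ RealQuintic.L1 p q r s t = 0 ∧
        RealQuintic.L2 p q r s = 0 ∧ RealQuintic.L3 p q ≠ 0 ∧ RealQuintic.M1 p q r s = 0) ∧
    (RealQuintic.RootClass.tripleDouble.Contains (RealQuintic.quintic p q r s t) ↔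
        RealQuintic.D p q r s t = 0 ∧ RealQuintic.L1 p q r s t = 0 ∧
        RealQuintic.L2 p q r s = 0 ∧ RealQuintic.L3 p q ≠ 0 ∧ RealQuintic.M1 p q r s ≠ 0) ∧
    (RealQuintic.RootClass.quintuple.Contains (RealQuintic.quintic p q r s t) ↔
        RealQuintic.D p q r s t = 0 ∧ RealQuintic.L1 p q r s t = 0 ∧
        RealQuintic.L2 p q r s = 0 ∧ RealQuintic.L3 p q = 0) := by
  refine ⟨?_, RealQuintic.RootClass.contains_iff_condition _ p q r s t,
    RealQuintic.RootClass.contains_iff_condition _ p q r s t,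
    RealQuintic.RootClass.contains_iff_condition _ p q r s t,
    RealQuintic.RootClass.contains_iff_condition _ p q r s t,
    RealQuintic.RootClass.contains_iff_condition _ p q r s t,
    RealQuintic.RootClass.contains_iff_condition _ p q r s t,
    RealQuintic.RootClass.contains_iff_condition _ p q r s t,
    RealQuintic.RootClass.contains_iff_condition _ p q r s t,
    RealQuintic.RootClass.contains_iff_condition _ p q r s t,
    RealQuintic.RootClass.contains_iff_condition _ p q r s t,
    RealQuintic.RootClass.contains_iff_condition _ p q r s t,
    RealQuintic.RootClass.contains_iff_condition _ p q r s t⟩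
  obtain ⟨c, h, -⟩ := RealQuintic.isClassified p q r s t
  exact ⟨c, h, fun c' h' => RealQuintic.RootClass.eq_of_contains h' h⟩
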